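/- Let $D\subset\mathbb{C}$ be a bounded domain (non-empty, open, connected). Let $H_s(D)$ be the space of real-valued $C^\infty$ functions with compact support in $D$, and let $H(D)$ be its Hilbert space completion for the Dirichlet inner product $(f,g)_\nabla=(2\pi)^{-1}\int_D\nabla f(z)\cdot\nabla g(z)\,dz$. Let $h$ be a Gaussian free field on $D$ with zero boundary conditions, i.e. a family of jointly Gaussian, mean zero random variables $(h,f)_\nabla$, $f\in H(D)$, on a probability space, with $\operatorname{Cov}\big((h,f)_\nabla,(h,g)_\nabla\big)=(f,g)_\nabla$. For $z\in\mathbb{C}$ and $\varepsilon>0$ let $h_\varepsilon(z):=(h,\xi^z_\varepsilon)_\nabla$ be the mean value of $h$ (taken to be zero outside $D$) on the circle $\partial B_\varepsilon(z)$, where $\xi_\varepsilon^z\in H(D)$ is the unique element such that, for every $f\in H_s(D)$ (extended by zero), $(\xi_\varepsilon^z,f)_\nabla$ is the mean value of $f$ on $\partial B_\varepsilon(z)$. Then the process $(h_\varepsilon(z))_{(z,\varepsilon)\in\mathbb{C}\times(0,\infty)}$ has a modification which almost surely is, for every $0<\eta<1/2$, locally $\eta$-Hölder continuous in the pair $(z,\varepsilon)\in\mathbb{C}\times(0,\infty)$.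 -/

import Mathlib

open MeasureTheory ProbabilityTheory TopologicalSpace Topology Set
open scoped Distributions NNReal ENNReal

noncomputable section

namespace GFF

/-! ### The Dirichlet space of a planar open set -/

/-- The space `H_s(D)` of real-valued `C^∞` functions on the plane with compact support contained
in `D`. It is Mathlib's space of test functions; the name is separate because `H_s(D)` carries the
Dirichlet inner product below, and not the usual topology of test functions. -/
def TestSpace (D : Opens ℂ) : Type := 𝓓(D, ℝ)

instance (D : Opens ℂ) : FunLike (TestSpace D) ℂ ℝ := inferInstanceAs (FunLike 𝓓(D, ℝ) ℂ ℝ)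
instance (D : Opens ℂ) : AddCommGroup (TestSpace D) := inferInstanceAs (AddCommGroup 𝓓(D, ℝ))
instance (D : Opens ℂ) : Module ℝ (TestSpace D) := inferInstanceAs (Module ℝ 𝓓(D, ℝ))

variable {D : Opens ℂ}

/-- The Dirichlet inner product `(f, g)_∇ = (2π)⁻¹ ∫_D ∇f(z) · ∇g(z) dz`. -/
def dirichletInner (D : Opens ℂ) (f g : TestSpace D) : ℝ :=
  (2 * Real.pi)⁻¹ * ∫ z in (D : Set ℂ), inner ℝ (gradient f z) (gradient g z)

theorem TestSpace.contDiff (f : TestSpace D) : ContDiff ℝ ((⊤ : ℕ∞) : WithTop ℕ∞) f :=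
  TestFunction.contDiff (Ω := D) (F := ℝ) (n := ⊤) f

theorem TestSpace.hasCompactSupport (f : TestSpace D) : HasCompactSupport f :=
  TestFunction.hasCompactSupport (Ω := D) (F := ℝ) (n := ⊤) f

theorem TestSpace.tsupport_subset (f : TestSpace D) : tsupport f ⊆ D :=
  TestFunction.tsupport_subset (Ω := D) (F := ℝ) (n := ⊤) f

theorem TestSpace.coe_add (f g : TestSpace D) : ⇑(f + g) = fun z => f z + g z := rfl

theorem TestSpace.coe_smul (c : ℝ) (f : TestSpace D) : ⇑(c • f) = fun z => c * f z := rfl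

theorem TestSpace.differentiable (f : TestSpace D) : Differentiable ℝ f :=
  f.contDiff.differentiable (by simp)

theorem TestSpace.continuous_gradient (f : TestSpace D) : Continuous (gradient f) :=
  (InnerProductSpace.toDual ℝ ℂ).symm.continuous.comp (f.contDiff.continuous_fderiv (by simp))

theorem TestSpace.hasCompactSupport_gradient (f : TestSpace D) :
    HasCompactSupport (gradient f) :=
  (f.hasCompactSupport.fderiv ℝ).comp_left (g := (InnerProductSpace.toDual ℝ ℂ).symm) (map_zero _)

theorem TestSpace.gradient_add (f g : TestSpace D) (z : ℂ) :
    gradient (f + g) z = gradient f z + gradient g z := by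
  rw [gradient, gradient, gradient, TestSpace.coe_add, ← map_add]
  congr 1
  exact fderiv_add (f.differentiable z) (g.differentiable z)

theorem TestSpace.gradient_smul (c : ℝ) (f : TestSpace D) (z : ℂ) :
    gradient (c • f) z = c • gradient f z := by
  rw [gradient, gradient, TestSpace.coe_smul, ← map_smul]
  congr 1
  exact fderiv_const_mul (f.differentiable z) c

theorem TestSpace.integrable_inner (f g : TestSpace D) :
    Integrable (fun z => inner ℝ (gradient f z) (gradient g z)) := by
  refine (f.continuous_gradient.inner g.continuous_gradient).integrable_of_hasCompactSupport ?_
  refine f.hasCompactSupport_gradient.mono ?_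
  intro z hz h
  exact hz (by simp [h])

instance (D : Opens ℂ) : PreInnerProductSpace.Core ℝ (TestSpace D) where
  inner f g := dirichletInner D f g
  conj_inner_symm f g := by
    simp only [dirichletInner, real_inner_comm, conj_trivial]
  re_inner_nonneg f := by
    simp only [dirichletInner, RCLike.re_to_real]
    have : 0 ≤ ∫ z in (D : Set ℂ), inner ℝ (gradient f z) (gradient f z) :=
      integral_nonneg fun z => real_inner_self_nonneg
    positivity
  add_left f g k := by
    simp only [dirichletInner, TestSpace.gradient_add, inner_add_left]
    rw [integral_add (f.integrable_inner k).integrableOn (g.integrable_inner k).integrableOn,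
      mul_add]
  smul_left f g c := by
    simp only [dirichletInner, TestSpace.gradient_smul, real_inner_smul_left, integral_const_mul,
      conj_trivial]
    ring

instance (D : Opens ℂ) : SeminormedAddCommGroup (TestSpace D) :=
  InnerProductSpace.Core.toSeminormedAddCommGroup (𝕜 := ℝ)

instance (D : Opens ℂ) : InnerProductSpace ℝ (TestSpace D) := .ofCore _

theorem TestSpace.inner_def (f g : TestSpace D) : inner ℝ f g = dirichletInner D f g := rfl

/-- The Hilbert space `H(D)`: the completion of `H_s(D)` for the Dirichlet inner product. -/
abbrev DirichletSpace (D : Opens ℂ) : Type := UniformSpace.Completion (TestSpace D)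

/-! ### The mean value on a circle as an element of the Dirichlet space -/

theorem TestSpace.norm_sq (f : TestSpace D) :
    ‖f‖ ^ 2 = (2 * Real.pi)⁻¹ * ∫ z in (D : Set ℂ), ‖gradient f z‖ ^ 2 := by
  rw [← real_inner_self_eq_norm_sq, TestSpace.inner_def, dirichletInner]
  simp only [real_inner_self_eq_norm_sq]

theorem TestSpace.gradient_eq_zero (f : TestSpace D) {z : ℂ} (hz : z ∉ (D : Set ℂ)) :
    gradient f z = 0 := by
  have h : fderiv ℝ f z = 0 := by
    by_contra h
    exact hz (f.tsupport_subset (support_fderiv_subset ℝ h))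
  simp [gradient, h]

theorem TestSpace.enorm_le_lintegral (f : TestSpace D) (z : ℂ) (ε θ : ℝ) :
    ‖f (circleMap z ε θ)‖ₑ ≤ ∫⁻ r in Ioi ε, ‖gradient f (circleMap z r θ)‖ₑ := by
  set u : ℂ := Complex.exp (θ * Complex.I) with hu
  have hu1 : ‖u‖ = 1 := Complex.norm_exp_ofReal_mul_I θ
  have hd : ∀ r : ℝ, HasDerivAt (fun r : ℝ => circleMap z r θ) u r := by
    intro r
    have h1 : HasDerivAt (fun r : ℝ => (r : ℂ)) 1 r := Complex.ofRealCLM.hasDerivAt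
    simpa [circleMap, hu] using (h1.mul_const u).const_add z
  have hcd : ContDiff ℝ ((⊤ : ℕ∞) : WithTop ℕ∞) (fun r : ℝ => circleMap z r θ) := by
    unfold circleMap
    exact contDiff_const.add (Complex.ofRealCLM.contDiff.mul contDiff_const)
  have hg : ContDiff ℝ 1 (fun r : ℝ => f (circleMap z r θ)) :=
    (f.contDiff.comp hcd).of_le (by simp)
  have hdist : Isometry (fun r : ℝ => circleMap z r θ) := by
    refine Isometry.of_dist_eq fun a b => ?_
    have : circleMap z a θ - circleMap z b θ = ((a - b : ℝ) : ℂ) * u := by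
      simp only [circleMap, hu]; push_cast; ring
    rw [dist_eq_norm, this, norm_mul, hu1, mul_one, Complex.norm_real, dist_eq_norm]
  have hcs : HasCompactSupport (fun r : ℝ => f (circleMap z r θ)) :=
    f.hasCompactSupport.comp_isClosedEmbedding hdist.isClosedEmbedding
  have hftc := hcs.integral_Ioi_deriv_eq hg ε
  have hderiv : ∀ r : ℝ, ‖deriv (fun r : ℝ => f (circleMap z r θ)) r‖ₑ
      ≤ ‖gradient f (circleMap z r θ)‖ₑ := by
    intro r
    have h1 := ((f.differentiable (circleMap z r θ)).hasFDerivAt).comp_hasDerivAt r (hd r)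
    have h2 : deriv (fun r : ℝ => f (circleMap z r θ)) r
        = inner ℝ (gradient f (circleMap z r θ)) u := by
      rw [inner_gradient_left]; exact h1.deriv
    rw [h2, enorm_le_iff_norm_le]
    calc _ ≤ ‖gradient f (circleMap z r θ)‖ * ‖u‖ := norm_inner_le_norm _ _
      _ = _ := by rw [hu1, mul_one]
  calc ‖f (circleMap z ε θ)‖ₑ
      = ‖∫ r in Ioi ε, deriv (fun r : ℝ => f (circleMap z r θ)) r‖ₑ := by
        rw [hftc, enorm_neg]
    _ ≤ ∫⁻ r in Ioi ε, ‖deriv (fun r : ℝ => f (circleMap z r θ)) r‖ₑ :=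
        enorm_integral_le_lintegral_enorm _
    _ ≤ _ := lintegral_mono hderiv

theorem TestSpace.enorm_circleAverage_le (f : TestSpace D) (z : ℂ) {ε : ℝ} (hε : 0 < ε) :
    ‖Real.circleAverage f z ε‖ₑ
      ≤ ENNReal.ofReal ((2 * Real.pi)⁻¹ * ε⁻¹) * ∫⁻ w in (D : Set ℂ), ‖gradient f w‖ₑ := by
  have hm : Measurable (fun p : ℝ × ℝ => ENNReal.ofReal p.1 * ‖gradient f (z + Complex.polarCoord.symm p)‖ₑ) := by
    have := f.continuous_gradient.measurable
    have h2 : Measurable (fun p : ℝ × ℝ => Complex.polarCoord.symm p) := by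
      simp only [Complex.polarCoord_symm_apply]
      fun_prop
    fun_prop
  have hpolar : ∀ r θ : ℝ, z + Complex.polarCoord.symm (r, θ) = circleMap z r θ := by
    intro r θ
    rw [Complex.polarCoord_symm_apply, circleMap, Complex.exp_mul_I]
    push_cast; ring
  have h1 : ∀ θ : ℝ, ‖f (circleMap z ε θ)‖ₑ ≤ ENNReal.ofReal ε⁻¹ *
      ∫⁻ r in Ioi (0 : ℝ),
        ENNReal.ofReal r * ‖gradient f (z + Complex.polarCoord.symm (r, θ))‖ₑ := by
    intro θ
    refine (f.enorm_le_lintegral z ε θ).trans ?_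
    rw [← lintegral_const_mul' _ _ ENNReal.ofReal_ne_top]
    refine (lintegral_mono_set (Ioi_subset_Ioi hε.le)).trans' ?_
    refine setLIntegral_mono' measurableSet_Ioi fun r hr => ?_
    rw [hpolar, ← mul_assoc, ← ENNReal.ofReal_mul (inv_pos.2 hε).le]
    refine le_mul_of_one_le_left zero_le ?_
    rw [ENNReal.one_le_ofReal, inv_mul_eq_div, one_le_div hε]
    exact le_of_lt hr
  have h2 : ∫⁻ θ in Ioo (-Real.pi) Real.pi, ∫⁻ r in Ioi (0 : ℝ),
      ENNReal.ofReal r * ‖gradient f (z + Complex.polarCoord.symm (r, θ))‖ₑ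
      = ∫⁻ w in (D : Set ℂ), ‖gradient f w‖ₑ := by
    rw [← lintegral_prod_symm (μ := volume.restrict (Ioi (0:ℝ)))
      (ν := volume.restrict (Ioo (-Real.pi) Real.pi))
      (fun p : ℝ × ℝ => ENNReal.ofReal p.1 * ‖gradient f (z + Complex.polarCoord.symm p)‖ₑ)
      hm.aemeasurable, Measure.prod_restrict]
    have := Complex.lintegral_comp_polarCoord_symm (fun w => ‖gradient f (z + w)‖ₑ)
    simp only [smul_eq_mul, polarCoord_target] at this
    rw [← Measure.volume_eq_prod, this, lintegral_add_left_eq_self (fun w => ‖gradient f w‖ₑ),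
      setLIntegral_eq_of_support_subset]
    intro w hw
    by_contra hwD
    exact hw (by simp [f.gradient_eq_zero hwD])
  have h3 : Real.circleAverage f z ε
      = (2 * Real.pi)⁻¹ * ∫ θ in Ioo (-Real.pi) Real.pi, f (circleMap z ε θ) := by
    rw [Real.circleAverage_eq_integral_add (-Real.pi), smul_eq_mul]
    congr 1
    rw [intervalIntegral.integral_comp_add_right (fun θ => f (circleMap z ε θ)),
      zero_add, intervalIntegral.integral_of_le (by linarith [Real.pi_pos]),
      integral_Ioc_eq_integral_Ioo]
    congr 3; ring
  rw [h3, enorm_mul, ← h2, ENNReal.ofReal_mul (by positivity), mul_assoc,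
    Real.enorm_of_nonneg (by positivity)]
  gcongr
  refine (enorm_integral_le_lintegral_enorm _).trans ?_
  rw [← lintegral_const_mul' _ _ ENNReal.ofReal_ne_top]
  exact lintegral_mono h1

/-- On a bounded domain, the mean value on a fixed circle is a bounded functional for the Dirichlet
norm. -/
theorem TestSpace.exists_circleAverage_bound (hD : Bornology.IsBounded (D : Set ℂ)) (z : ℂ)
    {ε : ℝ} (hε : 0 < ε) :
    ∃ C : ℝ, ∀ f : TestSpace D, ‖Real.circleAverage f z ε‖ ≤ C * ‖f‖ := by
  have hvol : volume (D : Set ℂ) ≠ ∞ := hD.measure_lt_top.ne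
  set a : ℝ := (2 * Real.pi)⁻¹ * ε⁻¹ with ha
  have ha0 : 0 ≤ a := by positivity
  set V : ℝ := (volume (D : Set ℂ)).toReal with hV
  refine ⟨a * (√V * √(2 * Real.pi)), fun f => ?_⟩
  have hfin : IntegrableOn (fun w => ‖gradient f w‖) (D : Set ℂ) :=
    (f.continuous_gradient.norm.integrable_of_hasCompactSupport
      f.hasCompactSupport_gradient.norm).integrableOn
  have h1 : ‖Real.circleAverage f z ε‖ ≤ a * ∫ w in (D : Set ℂ), ‖gradient f w‖ := by
    have h := f.enorm_circleAverage_le z hε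
    have hg : Integrable (gradient f) (volume.restrict (D : Set ℂ)) :=
      (f.continuous_gradient.integrable_of_hasCompactSupport
        f.hasCompactSupport_gradient).restrict
    rw [← ofReal_integral_norm_eq_lintegral_enorm hg, ← ENNReal.ofReal_mul ha0, ← ofReal_norm,
      ENNReal.ofReal_le_ofReal_iff (mul_nonneg ha0 (integral_nonneg fun _ => norm_nonneg _))] at h
    exact h
  have h2 : (∫ w in (D : Set ℂ), ‖gradient f w‖) ^ 2
      ≤ V * ∫ w in (D : Set ℂ), ‖gradient f w‖ ^ 2 := by
    have hc : MemLp (fun w => ‖gradient f w‖) (ENNReal.ofReal 2) (volume.restrict (D : Set ℂ)) :=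
      (f.continuous_gradient.norm.memLp_of_hasCompactSupport
        f.hasCompactSupport_gradient.norm).restrict _
    have h1m : MemLp (fun _ : ℂ => (1 : ℝ)) (ENNReal.ofReal 2)
        (volume.restrict (D : Set ℂ)) := by
      have : IsFiniteMeasure (volume.restrict (D : Set ℂ)) := ⟨by simpa using hvol.lt_top⟩
      exact memLp_const 1
    have hH := integral_mul_le_Lp_mul_Lq_of_nonneg (μ := volume.restrict (D : Set ℂ))
      Real.HolderConjugate.two_two (Filter.Eventually.of_forall fun _ => zero_le_one)
      (Filter.Eventually.of_forall fun w => norm_nonneg (gradient f w)) h1m hc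
    simp only [one_mul, one_pow, integral_const, smul_eq_mul, mul_one,
      ← Real.sqrt_eq_rpow, Real.rpow_ofNat, measureReal_restrict_apply_univ] at hH
    have h0 : 0 ≤ ∫ w in (D : Set ℂ), ‖gradient f w‖ := integral_nonneg fun _ => norm_nonneg _
    have h0' : 0 ≤ ∫ w in (D : Set ℂ), ‖gradient f w‖ ^ 2 := integral_nonneg fun _ => by positivity
    calc _ ≤ _ := pow_le_pow_left₀ h0 hH 2
      _ = _ := by
        rw [mul_pow, Real.sq_sqrt measureReal_nonneg, Real.sq_sqrt h0']; rfl
  have h3 : ∫ w in (D : Set ℂ), ‖gradient f w‖ ^ 2 = (2 * Real.pi) * ‖f‖ ^ 2 := by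
    rw [f.norm_sq]; field_simp
  rw [h3] at h2
  have h4 : ∫ w in (D : Set ℂ), ‖gradient f w‖ ≤ √V * √(2 * Real.pi) * ‖f‖ := by
    refine le_of_sq_le_sq ?_ (by positivity) |>.trans le_rfl
    rw [mul_pow, mul_pow, Real.sq_sqrt ENNReal.toReal_nonneg, Real.sq_sqrt (by positivity)]
    linarith
  calc _ ≤ _ := h1
    _ ≤ a * (√V * √(2 * Real.pi) * ‖f‖) := by gcongr
    _ = _ := by ring

/-- The functional `f ↦` (mean value of `f` on the circle of radius `ε` centred at `z`) on `H_s(D)`,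
where `f` is zero outside `D`; the circle need not be contained in `D`. -/
def circleFunctional (hD : Bornology.IsBounded (D : Set ℂ)) (p : ℂ × Ioi (0 : ℝ)) :
    TestSpace D →L[ℝ] ℝ :=
  LinearMap.mkContinuousOfExistsBound
    { toFun := fun f => Real.circleAverage f p.1 p.2
      map_add' := fun f g => Real.circleAverage_add
        f.contDiff.continuous.continuousOn.circleIntegrable'
        g.contDiff.continuous.continuousOn.circleIntegrable'
      map_smul' := fun c f => Real.circleAverage_fun_smul (a := c) (f := f) }
    (TestSpace.exists_circleAverage_bound hD p.1 p.2.2)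

theorem circleFunctional_apply (hD : Bornology.IsBounded (D : Set ℂ)) (p : ℂ × Ioi (0 : ℝ))
    (f : TestSpace D) : circleFunctional hD p f = Real.circleAverage f p.1 p.2 := rfl

/-- The element `ξ_ε^z` of `H(D)` that represents the mean value on the circle of radius `ε`
centred at `z`: the unique `ξ ∈ H(D)` with `(ξ, f)_∇ = ` mean value of `f` on this circle, for all
`f ∈ H_s(D)`. In other words, `ξ_ε^z` has zero boundary values and solves `-Δ ξ = 2π ρ_ε^z` weakly
in `D`, with `ρ_ε^z` the uniform probability measure on the circle. -/
def circleRep (hD : Bornology.IsBounded (D : Set ℂ)) (p : ℂ × Ioi (0 : ℝ)) : DirichletSpace D :=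
  (InnerProductSpace.toDual ℝ (DirichletSpace D)).symm (circleFunctional hD p).fromCompletion

theorem inner_circleRep (hD : Bornology.IsBounded (D : Set ℂ)) (p : ℂ × Ioi (0 : ℝ))
    (f : TestSpace D) :
    inner ℝ (circleRep hD p) (f : DirichletSpace D) = Real.circleAverage f p.1 p.2 := by
  rw [circleRep, InnerProductSpace.toDual_symm_apply,
    ContinuousLinearMap.fromCompletion_apply_coe, circleFunctional_apply]

/-! ### The Gaussian free field and its circle averages -/

/-- `h` is a (centred, zero boundary) Gaussian free field on `D` under `P`, that is, a standard
Gaussian on the Hilbert space `H(D)`: a family of random variables `h f = (h, f)_∇`, one for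
each `f ∈ H(D)`, that are jointly Gaussian with mean zero and
`Cov((h, f)_∇, (h, g)_∇) = (f, g)_∇`. -/
structure IsGaussianFreeField {Ω : Type*} [MeasurableSpace Ω] (P : Measure Ω) (D : Opens ℂ)
    (h : DirichletSpace D → Ω → ℝ) : Prop where
  isGaussianProcess : IsGaussianProcess h P
  integral_eq_zero : ∀ f, ∫ ω, h f ω ∂P = 0
  covariance_eq : ∀ f g, covariance (h f) (h g) P = inner ℝ f g

/-- The circle-average process `h_ε(z) = (h, ξ_ε^z)_∇`, indexed by `(z, ε) ∈ ℂ × (0, ∞)`: the mean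
value on the circle of radius `ε` centred at `z` of `h`, taken to be zero outside `D`. -/
def circleAverageProcess {Ω : Type*} (hD : Bornology.IsBounded (D : Set ℂ))
    (h : DirichletSpace D → Ω → ℝ) (p : ℂ × Ioi (0 : ℝ)) (ω : Ω) : ℝ :=
  h (circleRep hD p) ω

/-- `f` is locally `η`-Hölder continuous: every point has a neighbourhood on which `f` is Hölder
continuous with exponent `η` and some constant. -/
def LocallyHolder {X Y : Type*} [PseudoEMetricSpace X] [PseudoEMetricSpace Y] (η : ℝ≥0)
    (f : X → Y) : Prop :=
  ∀ x, ∃ C : ℝ≥0, ∃ t ∈ 𝓝 x, HolderOnWith C η f t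

end GFF

end

/-!
The proof is Kolmogorov's criterion applied to a variance bound.

**Variance bound.** Since `h` is a standard Gaussian on `H(D)`, the increment of the process between
two circles is Gaussian with standard deviation the distance of their representatives `ξ` in `H(D)`.
By duality this distance is the best constant in `|⨍_p f - ⨍_q f| ≤ c ‖f‖` over test functions `f`,
so no Green's function is needed. For two circles whose radii `r < s` differ by at least twice the
distance of their centres, interpolate linearly between them. The interpolating circles are strictly
nested, and they sweep out the plane without much compression: `circleShear`, which turns concentric
circles into them, is `2`-antilipschitz, hence multiplies areas by at least `1/4`. The fundamental
theorem of calculus along the sweep and Cauchy–Schwarz in polar coordinates then give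
`|⨍_p f - ⨍_q f|² ≤ 16 (s - r) / r ‖f‖²` (`TestSpace.sq_circleAverage_sub_le_of_nested`). Sliding one
circle directly onto another of the same radius would degenerate where the motion is tangential, so
two arbitrary circles are compared through a larger one that surrounds both. The outcome is
`dist_circleRep_le`: the distance of `ξ_p` and `ξ_q` is at most a constant times the square root of
the distance of `p` and `q`, as long as the radii stay away from `0`.

**Kolmogorov–Chentsov.** Gaussian moments turn this bound into `E|h_p - h_q|ⁿ ≤ C dist(p, q)^{n/2}`
for all `n`, locally uniformly. The criterion is proved for processes on `ℝ^d`
(`exists_modification_locallyHolder`): a weighted sum of the `n`-th powers of all increments between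
neighbouring dyadic points has finite mean, so that almost surely all these increments are small,
and chaining gives the Hölder bound for the limits along dyadic approximations. The set of
circles becomes `ℝ³` in the coordinates `(Re z, Im z, log ε)`, which are locally Lipschitz with
locally Lipschitz inverse.
-/

namespace GFF

/-! ### Antilipschitz maps and volume -/

/-- An antilipschitz self-map of a finite-dimensional space cannot compress volume too much: Haar
measure is a multiple of Hausdorff measure, for which this is immediate. -/
theorem _root_.AntilipschitzWith.volume_preimage_le {E : Type*} [NormedAddCommGroup E]
    [NormedSpace ℝ E] [FiniteDimensional ℝ E] [MeasureSpace E] [BorelSpace E]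
    [(volume : Measure E).IsAddHaarMeasure] {K : ℝ≥0} {Φ : E → E} (hΦ : AntilipschitzWith K Φ)
    (s : Set E) : volume (Φ ⁻¹' s) ≤ K ^ Module.finrank ℝ E * volume s := by
  have hv : (volume : Measure E) = Measure.addHaarScalarFactor volume
      (μH[(Module.finrank ℝ E : ℝ)] : Measure E) • μH[(Module.finrank ℝ E : ℝ)] :=
    Measure.isAddLeftInvariant_eq_smul _ _
  rw [hv, Measure.smul_apply, Measure.smul_apply, ENNReal.smul_def, ENNReal.smul_def, smul_eq_mul,
    smul_eq_mul, mul_left_comm]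
  have := hΦ.hausdorffMeasure_preimage_le (d := (Module.finrank ℝ E : ℝ)) (by positivity) s
  rw [ENNReal.rpow_natCast] at this
  gcongr

theorem _root_.AntilipschitzWith.lintegral_comp_le {E : Type*} [NormedAddCommGroup E]
    [NormedSpace ℝ E] [FiniteDimensional ℝ E] [MeasureSpace E] [BorelSpace E]
    [(volume : Measure E).IsAddHaarMeasure] {K : ℝ≥0} {Φ : E → E} (hΦ : AntilipschitzWith K Φ)
    (hm : Measurable Φ) {F : E → ℝ≥0∞} (hF : Measurable F) :
    ∫⁻ w, F (Φ w) ≤ K ^ Module.finrank ℝ E * ∫⁻ w, F w := by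
  have hle : (volume : Measure E).map Φ ≤ ((K : ℝ≥0∞) ^ Module.finrank ℝ E) • volume := by
    refine Measure.le_iff.2 fun s hs => ?_
    rw [Measure.map_apply hm hs]
    exact hΦ.volume_preimage_le s
  rw [← lintegral_map hF hm]
  refine (lintegral_mono' hle le_rfl).trans_eq ?_
  rw [lintegral_smul_measure, smul_eq_mul]

/-! ### Averages over nested circles -/

/-- The map that shears the circles centred at `0`: it sends the circle of radius `ρ` to the
circle of radius `ρ` centred at `z + (ρ - r) v`. For `‖v‖ < 1` the image circles are nested. -/
noncomputable def circleShear (z v : ℂ) (r : ℝ) (w : ℂ) : ℂ := z + w + (‖w‖ - r : ℝ) * v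

theorem continuous_circleShear (z v : ℂ) (r : ℝ) : Continuous (circleShear z v r) := by
  unfold circleShear; fun_prop

theorem antilipschitzWith_circleShear (z : ℂ) {v : ℂ} (hv : ‖v‖ ≤ 1 / 2) (r : ℝ) :
    AntilipschitzWith 2 (circleShear z v r) := by
  refine AntilipschitzWith.of_le_mul_dist fun a b => ?_
  have h1 : a - b = (circleShear z v r a - circleShear z v r b) - ((‖a‖ - ‖b‖ : ℝ) : ℂ) * v := by
    simp only [circleShear]; push_cast; ring
  have h2 : ‖((‖a‖ - ‖b‖ : ℝ) : ℂ) * v‖ ≤ ‖a - b‖ * (1 / 2) := by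
    rw [norm_mul, Complex.norm_real]
    exact mul_le_mul (abs_norm_sub_norm_le a b) hv (norm_nonneg _) (norm_nonneg _)
  have h3 := norm_sub_le (circleShear z v r a - circleShear z v r b) (((‖a‖ - ‖b‖ : ℝ) : ℂ) * v)
  rw [← h1] at h3
  rw [dist_eq_norm, dist_eq_norm]
  push_cast
  linarith

theorem lintegral_circleShear_le (z : ℂ) {v : ℂ} (hv : ‖v‖ ≤ 1 / 2) (r : ℝ) {F : ℂ → ℝ≥0∞}
    (hF : Measurable F) : ∫⁻ w, F (circleShear z v r w) ≤ 4 * ∫⁻ w, F w := by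
  have := (antilipschitzWith_circleShear z hv r).lintegral_comp_le
    (continuous_circleShear z v r).measurable hF
  rw [Complex.finrank_real_complex] at this
  refine this.trans_eq ?_
  norm_num

/-- The fundamental theorem of calculus along the image under `circleShear z v r` of the ray of
angle `θ`, whose speed is at most `1 + ‖v‖ ≤ 2`. -/
theorem TestSpace.enorm_sub_le_lintegral {D : Opens ℂ} (f : TestSpace D) (z : ℂ) {v : ℂ}
    (hv : ‖v‖ ≤ 1 / 2) {r s : ℝ} (hrs : r ≤ s) (θ : ℝ) :
    ‖f (circleMap (z + (s - r : ℝ) * v) s θ) - f (circleMap z r θ)‖ₑ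
      ≤ 2 * ∫⁻ ρ in Ioc r s, ‖gradient f (circleMap (z + (ρ - r : ℝ) * v) ρ θ)‖ₑ := by
  set u : ℂ := Complex.exp (θ * Complex.I) with hu
  have hu1 : ‖u‖ = 1 := Complex.norm_exp_ofReal_mul_I θ
  set γ : ℝ → ℂ := fun ρ => circleMap (z + (ρ - r : ℝ) * v) ρ θ with hγ
  have hd : ∀ ρ : ℝ, HasDerivAt γ (v + u) ρ := by
    intro ρ
    have h1 : HasDerivAt (fun r : ℝ => (r : ℂ)) 1 ρ := Complex.ofRealCLM.hasDerivAt
    have := (((h1.sub_const (r : ℂ)).mul_const v).const_add z).add (h1.mul_const u)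
    simp only [one_mul] at this
    refine this.congr_of_eventuallyEq (Filter.Eventually.of_forall fun x => ?_)
    simp [hγ, circleMap, hu]
  have hγc : Continuous γ := continuous_iff_continuousAt.2 fun ρ => (hd ρ).continuousAt
  have hfd : ∀ ρ : ℝ, HasDerivAt (fun ρ => f (γ ρ)) (inner ℝ (gradient f (γ ρ)) (v + u)) ρ := by
    intro ρ
    rw [inner_gradient_left]
    exact ((f.differentiable (γ ρ)).hasFDerivAt).comp_hasDerivAt ρ (hd ρ)
  have hftc := intervalIntegral.integral_eq_sub_of_hasDerivAt (a := r) (b := s)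
    (fun ρ _ => hfd ρ)
    (((f.continuous_gradient.comp hγc).inner continuous_const).intervalIntegrable _ _)
  have h0 : γ r = circleMap z r θ := by simp [hγ]
  rw [← h0, ← hftc, intervalIntegral.integral_of_le hrs,
    ← lintegral_const_mul' _ _ (by norm_num)]
  refine (enorm_integral_le_lintegral_enorm _).trans (lintegral_mono fun ρ => ?_)
  have h2 : ‖v + u‖ ≤ 2 := (norm_add_le _ _).trans (by rw [hu1]; linarith)
  have h3 : ‖(inner ℝ (gradient f (γ ρ)) (v + u) : ℝ)‖ ≤ 2 * ‖gradient f (γ ρ)‖ :=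
    (norm_inner_le_norm _ _).trans (by rw [mul_comm]; gcongr)
  rw [← ofReal_norm, ← ofReal_norm, show (2 : ℝ≥0∞) = ENNReal.ofReal 2 by simp,
    ← ENNReal.ofReal_mul (by norm_num)]
  exact ENNReal.ofReal_le_ofReal h3

/-- The Cauchy–Schwarz inequality against the constant function `1`. -/
theorem sq_lintegral_le {α : Type*} [MeasurableSpace α] (μ : Measure α) {G : α → ℝ≥0∞}
    (hG : AEMeasurable G μ) : (∫⁻ a, G a ∂μ) ^ 2 ≤ μ univ * ∫⁻ a, G a ^ 2 ∂μ := by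
  have h := ENNReal.lintegral_mul_le_Lp_mul_Lq μ Real.HolderConjugate.two_two
    (f := fun _ => 1) (g := G) aemeasurable_const hG
  simp only [Pi.mul_apply, one_mul, lintegral_const, ENNReal.rpow_ofNat, one_pow] at h
  calc (∫⁻ a, G a ∂μ) ^ 2
      ≤ (μ univ ^ (1 / 2 : ℝ) * (∫⁻ a, G a ^ 2 ∂μ) ^ (1 / 2 : ℝ)) ^ 2 := by gcongr
    _ = μ univ * ∫⁻ a, G a ^ 2 ∂μ := by
      rw [mul_pow, ← ENNReal.rpow_mul_natCast, ← ENNReal.rpow_mul_natCast]; norm_num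

theorem TestSpace.lintegral_enorm_gradient_sq {D : Opens ℂ} (f : TestSpace D) :
    ∫⁻ w, ‖gradient f w‖ₑ ^ 2 = ENNReal.ofReal (2 * Real.pi * ‖f‖ ^ 2) := by
  have hc : Integrable (fun w => ‖gradient f w‖ ^ 2) := by
    simpa only [real_inner_self_eq_norm_sq] using f.integrable_inner f
  have h1 : ∫ w in (D : Set ℂ), ‖gradient f w‖ ^ 2 = ∫ w, ‖gradient f w‖ ^ 2 :=
    setIntegral_eq_integral_of_forall_compl_eq_zero fun w hw => by simp [f.gradient_eq_zero hw]
  rw [f.norm_sq, h1, mul_inv_cancel_left₀ (by positivity),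
    ofReal_integral_eq_lintegral_ofReal hc (Filter.Eventually.of_forall fun w => by positivity)]
  refine lintegral_congr fun w => ?_
  rw [ENNReal.ofReal_pow (norm_nonneg _), ofReal_norm]

theorem TestSpace.circleAverage_eq_Ioo {D : Opens ℂ} (f : TestSpace D) (z : ℂ) (r : ℝ) :
    Real.circleAverage f z r
      = (2 * Real.pi)⁻¹ * ∫ θ in Ioo (-Real.pi) Real.pi, f (circleMap z r θ) := by
  rw [Real.circleAverage_eq_integral_add (-Real.pi), smul_eq_mul]
  congr 1
  rw [intervalIntegral.integral_comp_add_right (fun θ => f (circleMap z r θ)),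
    zero_add, intervalIntegral.integral_of_le (by linarith [Real.pi_pos]),
    integral_Ioc_eq_integral_Ioo]
  congr 3; ring

/-- The energy of `f` over the sheared annulus, in polar coordinates. The polar area element is
`ρ dρ dθ` with `ρ ≥ r`, which accounts for the factor `r⁻¹`. -/
theorem TestSpace.lintegral_polar_shear_le {D : Opens ℂ} (f : TestSpace D) (z : ℂ) {v : ℂ}
    (hv : ‖v‖ ≤ 1 / 2) {r s : ℝ} (hr : 0 < r) :
    ∫⁻ p in Ioc r s ×ˢ Ioo (-Real.pi) Real.pi,
        ‖gradient f (circleMap (z + (p.1 - r : ℝ) * v) p.1 p.2)‖ₑ ^ 2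
      ≤ ENNReal.ofReal (8 * Real.pi * r⁻¹ * ‖f‖ ^ 2) := by
  have hpolar : ∀ p : ℝ × ℝ, 0 < p.1 → circleShear z v r (Complex.polarCoord.symm p)
      = circleMap (z + (p.1 - r : ℝ) * v) p.1 p.2 := by
    rintro ⟨ρ, θ⟩ hρ
    rw [circleShear, Complex.norm_polarCoord_symm, abs_of_pos hρ, Complex.polarCoord_symm_apply,
      circleMap, Complex.exp_mul_I]
    push_cast; ring
  have hF : Measurable fun w => ‖gradient f w‖ₑ ^ 2 := by
    have := f.continuous_gradient.measurable
    fun_prop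
  calc _ ≤ ∫⁻ p in Ioc r s ×ˢ Ioo (-Real.pi) Real.pi, ENNReal.ofReal r⁻¹ *
        (ENNReal.ofReal p.1 • ‖gradient f (circleShear z v r (Complex.polarCoord.symm p))‖ₑ ^ 2) := by
        refine setLIntegral_mono' (measurableSet_Ioc.prod measurableSet_Ioo) fun p hp => ?_
        have hp1 : r < p.1 := hp.1.1
        rw [hpolar p (hr.trans hp1), smul_eq_mul, ← mul_assoc,
          ← ENNReal.ofReal_mul (inv_pos.2 hr).le]
        refine le_mul_of_one_le_left zero_le ?_
        rw [ENNReal.one_le_ofReal, inv_mul_eq_div, one_le_div hr]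
        exact hp1.le
    _ ≤ ∫⁻ p in polarCoord.target, ENNReal.ofReal r⁻¹ *
        (ENNReal.ofReal p.1 • ‖gradient f (circleShear z v r (Complex.polarCoord.symm p))‖ₑ ^ 2) := by
        refine lintegral_mono_set ?_
        rw [polarCoord_target]
        exact prod_mono (fun x hx => hr.trans hx.1) subset_rfl
    _ = ENNReal.ofReal r⁻¹ * ∫⁻ w, ‖gradient f (circleShear z v r w)‖ₑ ^ 2 := by
        rw [lintegral_const_mul' _ _ ENNReal.ofReal_ne_top]
        congr 1
        exact Complex.lintegral_comp_polarCoord_symm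
          (fun w => ‖gradient f (circleShear z v r w)‖ₑ ^ 2)
    _ ≤ ENNReal.ofReal r⁻¹ * (4 * ∫⁻ w, ‖gradient f w‖ₑ ^ 2) := by
        gcongr
        exact lintegral_circleShear_le z hv r hF
    _ = _ := by
        rw [f.lintegral_enorm_gradient_sq, show (4 : ℝ≥0∞) = ENNReal.ofReal 4 by simp,
          ← ENNReal.ofReal_mul (by norm_num), ← ENNReal.ofReal_mul (by positivity)]
        congr 1; ring

theorem TestSpace.sq_circleAverage_sub_le_of_shear {D : Opens ℂ} (f : TestSpace D) (z : ℂ) {v : ℂ}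
    (hv : ‖v‖ ≤ 1 / 2) {r s : ℝ} (hr : 0 < r) (hrs : r ≤ s) :
    (Real.circleAverage f (z + (s - r : ℝ) * v) s - Real.circleAverage f z r) ^ 2
      ≤ 16 * ((s - r) / r) * ‖f‖ ^ 2 := by
  set G : ℝ × ℝ → ℝ≥0∞ := fun p => ‖gradient f (circleMap (z + (p.1 - r : ℝ) * v) p.1 p.2)‖ₑ
    with hGdef
  have hG : Measurable G := by
    have := f.continuous_gradient.measurable
    have h2 : Measurable fun p : ℝ × ℝ => circleMap (z + (p.1 - r : ℝ) * v) p.1 p.2 := by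
      unfold circleMap; fun_prop
    fun_prop
  have hcont : ∀ (w : ℂ) (t : ℝ), IntegrableOn (fun θ => f (circleMap w t θ))
      (Ioo (-Real.pi) Real.pi) := fun w t =>
    ((f.contDiff.continuous.comp (continuous_circleMap w t)).integrableOn_Icc).mono_set
      Ioo_subset_Icc_self
  have h1 : ‖Real.circleAverage f (z + (s - r : ℝ) * v) s - Real.circleAverage f z r‖ₑ
      ≤ ENNReal.ofReal Real.pi⁻¹ * ∫⁻ p in Ioc r s ×ˢ Ioo (-Real.pi) Real.pi, G p := by
    rw [f.circleAverage_eq_Ioo, f.circleAverage_eq_Ioo, ← mul_sub,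
      ← integral_sub (hcont _ _) (hcont _ _), enorm_mul, Real.enorm_of_nonneg (by positivity)]
    have h2 : ENNReal.ofReal Real.pi⁻¹ = ENNReal.ofReal (2 * Real.pi)⁻¹ * 2 := by
      rw [show (2 : ℝ≥0∞) = ENNReal.ofReal 2 by simp, ← ENNReal.ofReal_mul (by positivity)]
      congr 1; field_simp
    rw [h2, mul_assoc]
    gcongr
    rw [Measure.volume_eq_prod, ← Measure.prod_restrict, lintegral_prod_symm _ hG.aemeasurable,
      ← lintegral_const_mul' _ _ (by norm_num)]
    exact (enorm_integral_le_lintegral_enorm _).trans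
      (lintegral_mono fun θ => f.enorm_sub_le_lintegral z hv hrs θ)
  have h3 : ‖Real.circleAverage f (z + (s - r : ℝ) * v) s - Real.circleAverage f z r‖ₑ ^ 2
      ≤ ENNReal.ofReal (16 * ((s - r) / r) * ‖f‖ ^ 2) := by
    calc _ ≤ _ := pow_le_pow_left₀ zero_le h1 2
      _ ≤ ENNReal.ofReal Real.pi⁻¹ ^ 2 * (volume (Ioc r s ×ˢ Ioo (-Real.pi) Real.pi) *
          ∫⁻ p in Ioc r s ×ˢ Ioo (-Real.pi) Real.pi, G p ^ 2) := by
          rw [mul_pow]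
          gcongr
          refine (sq_lintegral_le _ hG.aemeasurable).trans_eq ?_
          rw [Measure.restrict_apply_univ]
      _ ≤ ENNReal.ofReal Real.pi⁻¹ ^ 2 * (ENNReal.ofReal ((s - r) * (2 * Real.pi)) *
          ENNReal.ofReal (8 * Real.pi * r⁻¹ * ‖f‖ ^ 2)) := by
          gcongr
          · rw [Measure.volume_eq_prod, Measure.prod_prod, Real.volume_Ioc, Real.volume_Ioo,
              ← ENNReal.ofReal_mul (by linarith)]
            exact le_of_eq (by congr 1; ring)
          · exact f.lintegral_polar_shear_le z hv hr
      _ = _ := by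
          rw [← ENNReal.ofReal_pow (by positivity), ← ENNReal.ofReal_mul (by nlinarith [Real.pi_pos]),
            ← ENNReal.ofReal_mul (by positivity)]
          congr 1; field_simp; ring
  rw [← ofReal_norm, ← ENNReal.ofReal_pow (norm_nonneg _), Real.norm_eq_abs, sq_abs] at h3
  exact (ENNReal.ofReal_le_ofReal_iff (by have := sub_nonneg.2 hrs; positivity)).1 h3

/-- Circles that are nested with a margin: the centres are at most half as far apart as the
radii. -/
theorem TestSpace.sq_circleAverage_sub_le_of_nested {D : Opens ℂ} (f : TestSpace D) {z w : ℂ}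
    {r s : ℝ} (hr : 0 < r) (h : ‖w - z‖ ≤ (s - r) / 2) :
    (Real.circleAverage f w s - Real.circleAverage f z r) ^ 2 ≤ 16 * ((s - r) / r) * ‖f‖ ^ 2 := by
  have hrs : r ≤ s := by linarith [norm_nonneg (w - z)]
  rcases hrs.eq_or_lt with rfl | hlt
  · have : w = z := by simpa [sub_eq_zero] using h
    simp [this]
  · have h0 : 0 < s - r := sub_pos.2 hlt
    have h1 : (w : ℂ) = z + (s - r : ℝ) * ((w - z) / (s - r : ℝ)) := by
      rw [mul_div_cancel₀ _ (Complex.ofReal_ne_zero.2 h0.ne')]; ring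
    rw [h1]
    refine f.sq_circleAverage_sub_le_of_shear z ?_ hr hrs
    rw [norm_div, Complex.norm_real, Real.norm_of_nonneg h0.le, div_le_iff₀ h0]
    linarith

/-- Two arbitrary circles are compared through the circle with the centre `z` of the first one and
radius `t = max r s + 2d`, in which both are nested with the required margin. -/
theorem TestSpace.abs_circleAverage_sub_le {D : Opens ℂ} (f : TestSpace D)
    {r₀ : ℝ} (h₀ : 0 < r₀) {p q : ℂ × Ioi (0 : ℝ)} (hp : r₀ ≤ p.2) (hq : r₀ ≤ q.2) :
    |Real.circleAverage f p.1 p.2 - Real.circleAverage f q.1 q.2|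
      ≤ 14 * √(dist p q / r₀) * ‖f‖ := by
  obtain ⟨z, r, hr : 0 < r⟩ := p
  obtain ⟨w, s, hs : 0 < s⟩ := q
  simp only at hp hq ⊢
  set d := dist (z, (⟨r, hr⟩ : Ioi (0 : ℝ))) (w, (⟨s, hs⟩ : Ioi (0 : ℝ))) with hd
  have hzw : ‖z - w‖ ≤ d := by rw [← dist_eq_norm]; exact le_max_left _ _
  have hrs : |r - s| ≤ d := by rw [← Real.dist_eq]; exact le_max_right _ _
  have hd0 : 0 ≤ d := dist_nonneg
  obtain ⟨hrs1, hrs2⟩ := abs_le.1 hrs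
  set t := max r s + 2 * d with ht
  have key : ∀ {c : ℂ} {ρ : ℝ}, 0 < ρ → r₀ ≤ ρ → ‖z - c‖ ≤ (t - ρ) / 2 → t - ρ ≤ 3 * d →
      |Real.circleAverage f z t - Real.circleAverage f c ρ| ≤ 7 * √(d / r₀) * ‖f‖ := by
    intro c ρ hρ hρ₀ hc htρ
    refine abs_le_of_sq_le_sq ?_ (by positivity)
    rw [mul_pow, mul_pow, Real.sq_sqrt (by positivity)]
    refine (f.sq_circleAverage_sub_le_of_nested hρ hc).trans ?_
    have h1 : (t - ρ) / ρ ≤ 3 * (d / r₀) := by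
      rw [← mul_div_assoc]
      exact div_le_div₀ (by positivity) htρ h₀ hρ₀
    have h2 : 0 ≤ d / r₀ := by positivity
    calc 16 * ((t - ρ) / ρ) * ‖f‖ ^ 2 ≤ 16 * (3 * (d / r₀)) * ‖f‖ ^ 2 := by gcongr
      _ ≤ 7 ^ 2 * (d / r₀) * ‖f‖ ^ 2 := by rw [← mul_assoc]; gcongr; norm_num
  have hm : max r s ≤ min r s + d := by
    rcases le_total r s with h | h <;> simp [h] <;> linarith
  have e1 := key (c := z) hr hp (by
    rw [sub_self, norm_zero]; linarith [le_max_left r s]) (by linarith [min_le_left r s])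
  have e2 := key (c := w) hs hq (by linarith [le_max_right r s]) (by linarith [min_le_right r s])
  rw [abs_sub_comm] at e1
  calc _ ≤ _ := abs_sub_le _ (Real.circleAverage f z t) _
    _ ≤ _ := by linarith

/-- The canonical distance of the circle-average process is `1/2`-Hölder in `(z, ε)`, away from
`ε = 0`. -/
theorem dist_circleRep_le {D : Opens ℂ} (hD : Bornology.IsBounded (D : Set ℂ)) {r₀ : ℝ}
    (h₀ : 0 < r₀) {p q : ℂ × Ioi (0 : ℝ)} (hp : r₀ ≤ p.2) (hq : r₀ ≤ q.2) :
    dist (circleRep hD p) (circleRep hD q) ≤ 14 * √(dist p q / r₀) := by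
  set C := 14 * √(dist p q / r₀)
  have hC : 0 ≤ C := by positivity
  have h : ∀ x : DirichletSpace D, inner ℝ (circleRep hD p - circleRep hD q) x ≤ C * ‖x‖ := by
    intro x
    induction x using UniformSpace.Completion.induction_on with
    | hp => exact isClosed_le (by fun_prop) (by fun_prop)
    | ih f =>
      rw [inner_sub_left, inner_circleRep, inner_circleRep, UniformSpace.Completion.norm_coe]
      exact (le_abs_self _).trans (f.abs_circleAverage_sub_le h₀ hp hq)
  have h1 := h (circleRep hD p - circleRep hD q)
  rw [real_inner_self_eq_norm_sq, sq] at h1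
  rw [dist_eq_norm]
  rcases (norm_nonneg (circleRep hD p - circleRep hD q)).eq_or_lt with h2 | h2
  · rw [← h2]; exact hC
  · exact le_of_mul_le_mul_right h1 h2

/-! ### Dyadic approximation and chaining -/

/-- The point `2⁻ⁿ k` of the dyadic lattice of level `n` in `ℝ^d`. -/
noncomputable def dyadicPoint {d : ℕ} (n : ℕ) (k : Fin d → ℤ) : Fin d → ℝ := fun i => k i / 2 ^ n

/-- The index of the lower corner of the dyadic cube of level `n` that contains `x`. -/
noncomputable def dyadicFloor {d : ℕ} (n : ℕ) (x : Fin d → ℝ) : Fin d → ℤ :=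
  fun i => ⌊2 ^ n * x i⌋

/-- The indices of the points of the dyadic lattice of level `n` in the cube `[-M, M]^d`. -/
noncomputable def dyadicBox (d M n : ℕ) : Finset (Fin d → ℤ) :=
  Finset.Icc (fun _ => -(M * 2 ^ n)) (fun _ => M * 2 ^ n)

/-- The increments of `f` between neighbouring points of the dyadic lattices in `[-M, M]^d` are
those of an `η`-Hölder function. The neighbours of a lattice point are the `3^d` points that differ
from it by at most one lattice step in every coordinate, itself included. -/
def DyadicHolder {d : ℕ} (f : (Fin d → ℝ) → ℝ) (M : ℕ) (B η : ℝ) : Prop :=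
  ∀ n, ∀ k ∈ dyadicBox d M n, ∀ e ∈ Finset.Icc (-1 : Fin d → ℤ) 1,
    |f (dyadicPoint n (k + e)) - f (dyadicPoint n k)| ≤ B * ((2 : ℝ) ^ (-η)) ^ n

/-- The limit of `f` along the dyadic approximations of `x` from below; a `limsup`, so that it is
measurable in a parameter without knowledge of convergence. -/
noncomputable def dyadicLimit {d : ℕ} (f : (Fin d → ℝ) → ℝ) (x : Fin d → ℝ) : ℝ :=
  Filter.limsup (fun n => f (dyadicPoint n (dyadicFloor n x))) Filter.atTop

theorem dyadicFloor_mem {d M : ℕ} {x : Fin d → ℝ} (hx : ‖x‖ ≤ M) (n : ℕ) :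
    dyadicFloor n x ∈ dyadicBox d M n := by
  rw [dyadicBox, Finset.mem_Icc, Pi.le_def, Pi.le_def, ← forall_and]
  intro i
  have hi := abs_le.1 ((norm_le_pi_norm x i).trans hx)
  have h2 : (0 : ℝ) < 2 ^ n := by positivity
  simp only [dyadicFloor]
  constructor
  · rw [Int.le_floor]; push_cast; nlinarith [hi.1]
  · have : ((⌊2 ^ n * x i⌋ : ℤ) : ℝ) ≤ ((M * 2 ^ n : ℤ) : ℝ) := by
      push_cast
      exact (Int.floor_le _).trans (by nlinarith [hi.2])
    exact_mod_cast this

theorem dyadicPoint_two_mul {d : ℕ} (n : ℕ) (k : Fin d → ℤ) :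
    dyadicPoint (n + 1) (2 * k) = dyadicPoint n k := by
  ext i
  simp only [dyadicPoint, Pi.mul_apply, Pi.ofNat_apply]
  push_cast
  rw [pow_succ]
  field_simp

theorem dist_dyadicPoint_dyadicFloor_le {d : ℕ} (n : ℕ) (x : Fin d → ℝ) :
    dist (dyadicPoint n (dyadicFloor n x)) x ≤ (1 / 2) ^ n := by
  refine (dist_pi_le_iff (by positivity)).2 fun i => ?_
  have h1 := Int.floor_le (2 ^ n * x i)
  have h2 := Int.lt_floor_add_one (2 ^ n * x i)
  have h3 : (0 : ℝ) < 2 ^ n := by positivity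
  have h4 : dyadicPoint n (dyadicFloor n x) i - x i
      = ((⌊2 ^ n * x i⌋ : ℤ) - 2 ^ n * x i) / 2 ^ n := by
    simp only [dyadicPoint, dyadicFloor]; field_simp
  rw [Real.dist_eq, h4, abs_div, abs_of_pos h3, one_div, inv_pow, div_le_iff₀ h3,
    inv_mul_cancel₀ h3.ne', abs_le]
  constructor <;> linarith

theorem dyadicFloor_succ_sub_mem {d : ℕ} (n : ℕ) (x : Fin d → ℝ) :
    dyadicFloor (n + 1) x - 2 * dyadicFloor n x ∈ Finset.Icc (-1 : Fin d → ℤ) 1 := by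
  rw [Finset.mem_Icc, Pi.le_def, Pi.le_def, ← forall_and]
  intro i
  simp only [dyadicFloor, Pi.sub_apply, Pi.mul_apply, Pi.neg_apply, Pi.ofNat_apply]
  have h1 := Int.floor_le (2 ^ n * x i)
  have h2 := Int.lt_floor_add_one (2 ^ n * x i)
  have h3 := Int.floor_le (2 ^ (n + 1) * x i)
  have h4 := Int.lt_floor_add_one (2 ^ (n + 1) * x i)
  rw [pow_succ] at h3 h4 ⊢
  set a := ⌊2 ^ n * x i⌋
  set b := ⌊2 ^ n * 2 * x i⌋
  have h5 : (b : ℝ) < ((2 * a + 2 : ℤ) : ℝ) := by push_cast; linarith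
  have h6 : ((2 * a - 1 : ℤ) : ℝ) < (b : ℝ) := by push_cast; linarith
  rw [Int.cast_lt] at h5 h6
  omega

theorem dyadicFloor_sub_mem {d n : ℕ} {x y : Fin d → ℝ} (hxy : dist x y ≤ (1 / 2) ^ n) :
    dyadicFloor n y - dyadicFloor n x ∈ Finset.Icc (-1 : Fin d → ℤ) 1 := by
  rw [Finset.mem_Icc, Pi.le_def, Pi.le_def, ← forall_and]
  intro i
  simp only [dyadicFloor, Pi.sub_apply, Pi.neg_apply, Pi.one_apply]
  have h0 : |x i - y i| ≤ (1 / 2) ^ n := (dist_le_pi_dist x y i).trans hxy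
  have h5 : (0 : ℝ) < 2 ^ n := by positivity
  have h6 : |2 ^ n * x i - 2 ^ n * y i| ≤ 1 := by
    rw [← mul_sub, abs_mul, abs_of_pos h5]
    rw [one_div, inv_pow] at h0
    calc _ ≤ (2 : ℝ) ^ n * (2 ^ n)⁻¹ := by gcongr
      _ = 1 := mul_inv_cancel₀ h5.ne'
  obtain ⟨h7, h8⟩ := abs_le.1 h6
  have h1 := Int.floor_le (2 ^ n * x i)
  have h2 := Int.lt_floor_add_one (2 ^ n * x i)
  have h3 := Int.floor_le (2 ^ n * y i)
  have h4 := Int.lt_floor_add_one (2 ^ n * y i)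
  set a := ⌊2 ^ n * x i⌋
  set b := ⌊2 ^ n * y i⌋
  have h9 : (b : ℝ) < ((a + 2 : ℤ) : ℝ) := by push_cast; linarith
  have h10 : ((a - 2 : ℤ) : ℝ) < (b : ℝ) := by push_cast; linarith
  rw [Int.cast_lt] at h9 h10
  omega

theorem two_rpow_neg_lt_one {η : ℝ} (hη : 0 < η) : (2 : ℝ) ^ (-η) < 1 :=
  Real.rpow_lt_one_of_one_lt_of_neg one_lt_two (neg_lt_zero.2 hη)

namespace DyadicHolder

variable {d : ℕ} {f : (Fin d → ℝ) → ℝ} {M : ℕ} {B η : ℝ}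

theorem dist_succ_le (hf : DyadicHolder f M B η) (hB : 0 ≤ B) (hη : 0 < η) {x : Fin d → ℝ}
    (hx : ‖x‖ ≤ M) (n : ℕ) :
    dist (f (dyadicPoint n (dyadicFloor n x))) (f (dyadicPoint (n + 1) (dyadicFloor (n + 1) x)))
      ≤ B * ((2 : ℝ) ^ (-η)) ^ n := by
  have hk : 2 * dyadicFloor n x ∈ dyadicBox d M (n + 1) := by
    have := dyadicFloor_mem hx n
    rw [dyadicBox, Finset.mem_Icc, Pi.le_def, Pi.le_def, ← forall_and] at this ⊢
    intro i
    have := this i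
    simp only [Pi.mul_apply, Pi.ofNat_apply, pow_succ] at this ⊢
    constructor <;> linarith [this.1, this.2]
  have h := hf (n + 1) _ hk _ (dyadicFloor_succ_sub_mem n x)
  rw [add_sub_cancel, dyadicPoint_two_mul] at h
  rw [dist_comm, Real.dist_eq]
  refine h.trans ?_
  exact mul_le_mul_of_nonneg_left
    (pow_le_pow_of_le_one (by positivity) (two_rpow_neg_lt_one hη).le n.le_succ) hB

theorem tendsto_dyadicLimit (hf : DyadicHolder f M B η) (hB : 0 ≤ B) (hη : 0 < η)
    {x : Fin d → ℝ} (hx : ‖x‖ ≤ M) :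
    Filter.Tendsto (fun n => f (dyadicPoint n (dyadicFloor n x))) Filter.atTop
      (𝓝 (dyadicLimit f x)) := by
  obtain ⟨a, ha⟩ := cauchySeq_tendsto_of_complete
    (cauchySeq_of_le_geometric _ B (two_rpow_neg_lt_one hη) (hf.dist_succ_le hB hη hx))
  rwa [dyadicLimit, ha.limsup_eq]

theorem dist_dyadicLimit_le (hf : DyadicHolder f M B η) (hB : 0 ≤ B) (hη : 0 < η)
    {x : Fin d → ℝ} (hx : ‖x‖ ≤ M) (n : ℕ) :
    dist (f (dyadicPoint n (dyadicFloor n x))) (dyadicLimit f x)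
      ≤ B * ((2 : ℝ) ^ (-η)) ^ n / (1 - (2 : ℝ) ^ (-η)) :=
  dist_le_of_le_geometric_of_tendsto _ B (two_rpow_neg_lt_one hη) (hf.dist_succ_le hB hη hx)
    (hf.tendsto_dyadicLimit hB hη hx) n

/-- Chaining: two points at distance about `2⁻ⁿ` are joined through their dyadic approximations
of level `n`, which are neighbours. -/
theorem exists_dist_dyadicLimit_le (hf : DyadicHolder f M B η) (hB : 0 ≤ B) (hη : 0 < η) :
    ∃ C : ℝ, 0 ≤ C ∧ ∀ x y : Fin d → ℝ, ‖x‖ ≤ M → ‖y‖ ≤ M → dist x y ≤ 1 →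
      dist (dyadicLimit f x) (dyadicLimit f y) ≤ C * dist x y ^ η := by
  set ρ : ℝ := (2 : ℝ) ^ (-η) with hρ
  have hρ0 : 0 < ρ := by positivity
  have hρ1 : 0 < 1 - ρ := sub_pos.2 (two_rpow_neg_lt_one hη)
  set A : ℝ := B / (1 - ρ) + B + B / (1 - ρ) with hA
  have hA0 : 0 ≤ A := by positivity
  refine ⟨A * 2 ^ η, by positivity, fun x y hx hy hxy => ?_⟩
  rcases eq_or_ne x y with rfl | hne
  · rw [dist_self]; positivity
  obtain ⟨n, hn1, hn2⟩ := exists_nat_pow_near_of_lt_one (dist_pos.2 hne) hxy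
    (y := (1 / 2 : ℝ)) (by norm_num) (by norm_num)
  have h1 := hf.dist_dyadicLimit_le hB hη hx n
  have h2 := hf.dist_dyadicLimit_le hB hη hy n
  have h3 := hf n _ (dyadicFloor_mem hx n) _ (dyadicFloor_sub_mem hn2)
  rw [add_sub_cancel, abs_sub_comm, ← Real.dist_eq] at h3
  have h4 : dist (dyadicLimit f x) (dyadicLimit f y) ≤ A * ρ ^ n := by
    rw [dist_comm] at h1
    calc _ ≤ _ := dist_triangle4 _ _ _ _
      _ ≤ _ := add_le_add (add_le_add h1 h3) h2
      _ = _ := by rw [hA, hρ]; ring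
  have h5 : ρ ^ n = 2 ^ η * ((1 / 2 : ℝ) ^ (n + 1)) ^ η := by
    rw [← Real.mul_rpow (by norm_num) (by positivity), pow_succ', ← mul_assoc, hρ,
      Real.rpow_neg (by norm_num), ← Real.inv_rpow (by norm_num), Real.rpow_pow_comm (by norm_num)]
    norm_num
  calc _ ≤ _ := h4
    _ = A * 2 ^ η * ((1 / 2 : ℝ) ^ (n + 1)) ^ η := by rw [h5, mul_assoc]
    _ ≤ _ := by gcongr

theorem anti (hf : DyadicHolder f M B η) (hB : 0 ≤ B) {η' : ℝ} (h : η' ≤ η) :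
    DyadicHolder f M B η' := fun n k hk e he => (hf n k hk e he).trans (by
  gcongr
  exact one_le_two)

end DyadicHolder

/-! ### The Kolmogorov–Chentsov criterion on `ℝ^d` -/

theorem card_dyadicBox_le (d M n : ℕ) :
    (dyadicBox d M n).card ≤ (2 * M + 1) ^ d * (2 ^ d) ^ n := by
  rw [dyadicBox, Pi.card_Icc]
  simp only [Int.card_Icc, Finset.prod_const, Finset.card_univ, Fintype.card_fin]
  rw [← pow_mul, mul_comm d n, pow_mul, ← mul_pow]
  gcongr
  have : (M * 2 ^ n + 1 - -(M * 2 ^ n) : ℤ).toNat = 2 * M * 2 ^ n + 1 := by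
    have : (M * 2 ^ n + 1 - -(M * 2 ^ n) : ℤ) = ((2 * M * 2 ^ n + 1 : ℕ) : ℤ) := by
      push_cast; ring
    rw [this, Int.toNat_natCast]
  rw [this, add_mul, one_mul]
  gcongr
  exact Nat.one_le_two_pow

theorem dyadicPoint_norm_le {d M n : ℕ} {k : Fin d → ℤ} (hk : k ∈ dyadicBox d M n) :
    ‖dyadicPoint n k‖ ≤ M := by
  rw [dyadicBox, Finset.mem_Icc, Pi.le_def, Pi.le_def, ← forall_and] at hk
  refine (pi_norm_le_iff_of_nonneg (by positivity)).2 fun i => ?_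
  have h3 : (0 : ℝ) < 2 ^ n := by positivity
  rw [dyadicPoint, Real.norm_eq_abs, abs_div, abs_of_pos h3, div_le_iff₀ h3]
  exact_mod_cast abs_le.2 (hk i)

theorem dist_dyadicPoint_add_le {d n : ℕ} {k e : Fin d → ℤ}
    (he : e ∈ Finset.Icc (-1 : Fin d → ℤ) 1) :
    dist (dyadicPoint n (k + e)) (dyadicPoint n k) ≤ (1 / 2) ^ n := by
  rw [Finset.mem_Icc, Pi.le_def, Pi.le_def, ← forall_and] at he
  refine (dist_pi_le_iff (by positivity)).2 fun i => ?_
  have h3 : (0 : ℝ) < 2 ^ n := by positivity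
  have h4 : dyadicPoint n (k + e) i - dyadicPoint n k i = (e i : ℝ) / 2 ^ n := by
    simp only [dyadicPoint, Pi.add_apply]; push_cast; ring
  rw [Real.dist_eq, h4, abs_div, abs_of_pos h3, one_div, inv_pow, div_le_iff₀ h3,
    inv_mul_cancel₀ h3.ne']
  exact_mod_cast abs_le.2 (he i)

section Modification

variable {Ω : Type*} [MeasurableSpace Ω] {P : Measure Ω} {d : ℕ}

/-- There are about `2^{dn}` neighbouring pairs of level `n`, each of which contributes at most
`C 2^{-γpn}` to the `p`-th moments. So the sum of the `p`-th powers of all increments, with weight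
`2^{ηpn}` at level `n`, has finite mean as soon as `d + ηp < γp`. The moment bound is assumed on a
cube larger than `[-M, M]^d`, since neighbours of boundary points lie outside. -/
theorem ae_exists_dyadicHolder {Y : (Fin d → ℝ) → Ω → ℝ} (hY : ∀ x, Measurable (Y x)) {γ η : ℝ}
    {M p : ℕ} {C : ℝ≥0} (hp : 0 < p) (hpd : d + η * p < γ * p) (hγ : 0 < γ)
    (hC : ∀ u v : Fin d → ℝ, ‖u‖ ≤ (M + 1 : ℕ) → ‖v‖ ≤ (M + 1 : ℕ) →
      ∫⁻ ω, ‖Y u ω - Y v ω‖ₑ ^ p ∂P ≤ C * edist u v ^ (γ * p)) :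
    ∀ᵐ ω ∂P, ∃ B : ℝ, 0 ≤ B ∧ DyadicHolder (fun x => Y x ω) M B η := by
  set E := Finset.Icc (-1 : Fin d → ℤ) 1 with hE
  set a : ℝ := (2 : ℝ) ^ η with ha
  have ha0 : 0 < a := by positivity
  set θ : ℝ := 2 ^ d * (a ^ p * (1 / 2) ^ (γ * p)) with hθ
  have hθ0 : 0 < θ := by positivity
  have hθ1 : θ < 1 := by
    have : θ = (2 : ℝ) ^ (d + η * p - γ * p) := by
      rw [Real.rpow_sub two_pos, Real.rpow_add two_pos, Real.rpow_mul two_pos.le, Real.rpow_natCast,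
        Real.rpow_natCast, hθ, one_div, Real.inv_rpow two_pos.le]
      ring
    rw [this]
    exact Real.rpow_lt_one_of_one_lt_of_neg one_lt_two (by linarith)
  set T : ℕ → (Fin d → ℤ) → (Fin d → ℤ) → Ω → ℝ≥0∞ := fun n k e ω =>
    ENNReal.ofReal (a ^ n) ^ p * ‖Y (dyadicPoint n (k + e)) ω - Y (dyadicPoint n k) ω‖ₑ ^ p with hT
  have hTm : ∀ n k e, Measurable (T n k e) := fun n k e => by
    have h1 := hY (dyadicPoint n (k + e))
    have h2 := hY (dyadicPoint n k)
    fun_prop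
  set S : Ω → ℝ≥0∞ := fun ω => ∑' n, ∑ k ∈ dyadicBox d M n, ∑ e ∈ E, T n k e ω with hS
  have hSm : Measurable S := by
    refine Measurable.tsum fun n => Finset.measurable_fun_sum _ fun k _ =>
      Finset.measurable_fun_sum _ fun e _ => hTm n k e
  have hTle : ∀ n, ∀ k ∈ dyadicBox d M n, ∀ e ∈ E,
      ∫⁻ ω, T n k e ω ∂P ≤ C * ENNReal.ofReal ((a ^ p * (1 / 2) ^ (γ * p)) ^ n) := by
    intro n k hk e he
    have hd := dist_dyadicPoint_add_le (n := n) (k := k) he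
    have hk1 := dyadicPoint_norm_le hk
    have hk2 : ‖dyadicPoint n (k + e)‖ ≤ M + 1 := by
      have h1 : ((1 : ℝ) / 2) ^ n ≤ 1 := pow_le_one₀ (by norm_num) (by norm_num)
      have h2 := norm_le_norm_add_norm_sub' (dyadicPoint n (k + e)) (dyadicPoint n k)
      rw [← dist_eq_norm] at h2
      linarith
    calc ∫⁻ ω, T n k e ω ∂P
        = ENNReal.ofReal (a ^ n) ^ p *
          ∫⁻ ω, ‖Y (dyadicPoint n (k + e)) ω - Y (dyadicPoint n k) ω‖ₑ ^ p ∂P :=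
          lintegral_const_mul' _ _ (ENNReal.pow_ne_top ENNReal.ofReal_ne_top)
      _ ≤ ENNReal.ofReal (a ^ n) ^ p *
          (C * edist (dyadicPoint n (k + e)) (dyadicPoint n k) ^ (γ * p)) := by
          gcongr
          exact hC _ _ (by push_cast; exact hk2) (by push_cast; linarith)
      _ ≤ ENNReal.ofReal (a ^ n) ^ p * (C * ENNReal.ofReal ((1 / 2) ^ n) ^ (γ * p)) := by
          gcongr
          rw [edist_dist]
          exact ENNReal.ofReal_le_ofReal hd
      _ = _ := by
          rw [mul_left_comm, ENNReal.ofReal_rpow_of_pos (by positivity),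
            ← ENNReal.ofReal_pow (by positivity), ← ENNReal.ofReal_mul (by positivity)]
          congr 2
          rw [mul_pow, ← Real.rpow_pow_comm (by norm_num), ← pow_mul, ← pow_mul, mul_comm n p]
  have hSint : ∫⁻ ω, S ω ∂P ≠ ∞ := by
    have h1 : ∫⁻ ω, S ω ∂P ≤ ∑' n : ℕ, (((2 * M + 1) ^ d * E.card : ℕ) * C : ℝ≥0∞) *
        ENNReal.ofReal θ ^ n := by
      rw [hS, lintegral_tsum fun n => (Finset.measurable_fun_sum _ fun k _ =>
        Finset.measurable_fun_sum _ fun e _ => hTm n k e).aemeasurable]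
      refine ENNReal.tsum_le_tsum fun n => ?_
      rw [lintegral_finsetSum _ fun k _ => Finset.measurable_fun_sum _ fun e _ => hTm n k e]
      calc _ ≤ ∑ k ∈ dyadicBox d M n, ∑ e ∈ E,
            C * ENNReal.ofReal ((a ^ p * (1 / 2) ^ (γ * p)) ^ n) := by
            refine Finset.sum_le_sum fun k hk => ?_
            rw [lintegral_finsetSum _ fun e _ => hTm n k e]
            exact Finset.sum_le_sum fun e he => hTle n k hk e he
        _ = ((dyadicBox d M n).card * E.card : ℕ) *
            (C * ENNReal.ofReal ((a ^ p * (1 / 2) ^ (γ * p)) ^ n)) := by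
            rw [Finset.sum_const, Finset.sum_const, smul_smul, nsmul_eq_mul]
        _ ≤ ((2 * M + 1) ^ d * (2 ^ d) ^ n * E.card : ℕ) *
            (C * ENNReal.ofReal ((a ^ p * (1 / 2) ^ (γ * p)) ^ n)) := by
            gcongr
            exact card_dyadicBox_le d M n
        _ = _ := by
            rw [← ENNReal.ofReal_pow hθ0.le, hθ, mul_pow (2 ^ d) _ n,
              ENNReal.ofReal_mul (by positivity)]
            have : ENNReal.ofReal (((2 : ℝ) ^ d) ^ n) = (2 ^ d) ^ n := by
              rw [ENNReal.ofReal_pow (by positivity), ENNReal.ofReal_pow (by positivity)]; simp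
            rw [this]
            push_cast
            ring
    refine ne_top_of_le_ne_top ?_ h1
    rw [ENNReal.tsum_mul_left]
    refine ENNReal.mul_ne_top (ENNReal.mul_ne_top (ENNReal.natCast_ne_top _) ENNReal.coe_ne_top) ?_
    rw [ENNReal.tsum_geometric]
    exact ENNReal.inv_ne_top.2 (tsub_pos_iff_lt.2 (by simpa using hθ1)).ne'
  filter_upwards [ae_lt_top hSm hSint] with ω hω
  refine ⟨1 + (S ω).toReal, by positivity, fun n k hk e he => ?_⟩
  set Δ := |Y (dyadicPoint n (k + e)) ω - Y (dyadicPoint n k) ω| with hΔ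
  have h1 : T n k e ω ≤ S ω :=
    ((Finset.single_le_sum (f := fun e => T n k e ω) (fun _ _ => zero_le) he).trans
      (Finset.single_le_sum (f := fun k => ∑ e ∈ E, T n k e ω) (fun _ _ => zero_le) hk)).trans
      (ENNReal.le_tsum n)
  have h2 : T n k e ω = ENNReal.ofReal ((a ^ n * Δ) ^ p) := by
    rw [mul_pow, ENNReal.ofReal_mul (by positivity), ENNReal.ofReal_pow (by positivity),
      ENNReal.ofReal_pow (abs_nonneg _), ← Real.norm_eq_abs, ofReal_norm]
  rw [h2, ENNReal.ofReal_le_iff_le_toReal hω.ne] at h1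
  have h3 : a ^ n * Δ ≤ 1 + (S ω).toReal := by
    -- `x ≤ 1` or `x ≤ x ^ p`, which avoids taking a `p`-th root of the bound
    rcases le_total (a ^ n * Δ) 1 with h | h
    · linarith [ENNReal.toReal_nonneg (a := S ω)]
    · linarith [le_self_pow₀ h hp.ne']
  rw [Real.rpow_neg two_pos.le, ← ha, inv_pow, ← div_eq_mul_inv, le_div_iff₀ (by positivity),
    mul_comm]
  exact h3

theorem ae_forall_exists_dyadicHolder {Y : (Fin d → ℝ) → Ω → ℝ} (hY : ∀ x, Measurable (Y x))
    {γ : ℝ} (hγ : 0 < γ)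
    (hmom : ∀ M n : ℕ, ∃ C : ℝ≥0, ∀ u v : Fin d → ℝ, ‖u‖ ≤ M → ‖v‖ ≤ M →
      ∫⁻ ω, ‖Y u ω - Y v ω‖ₑ ^ n ∂P ≤ C * edist u v ^ (γ * n)) :
    ∀ᵐ ω ∂P, ∀ M : ℕ, ∀ η < γ, ∃ B : ℝ, 0 ≤ B ∧ DyadicHolder (fun x => Y x ω) M B η := by
  have h1 : ∀ᵐ ω ∂P, ∀ M j : ℕ, ∃ B : ℝ, 0 ≤ B ∧
      DyadicHolder (fun x => Y x ω) M B (γ - 1 / (j + 1)) := by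
    rw [ae_all_iff]; intro M
    rw [ae_all_iff]; intro j
    -- the exponent `η = γ - 1 / (j + 1)` needs a moment of order `p > d (j + 1)`
    obtain ⟨C, hC⟩ := hmom (M + 1) ((d + 1) * (j + 1))
    refine ae_exists_dyadicHolder hY (by positivity) ?_ hγ hC
    push_cast
    field_simp
    linarith
  filter_upwards [h1] with ω hω M η hη
  obtain ⟨j, hj⟩ := exists_nat_one_div_lt (sub_pos.2 hη)
  obtain ⟨B, hB, h⟩ := hω M j
  exact ⟨B, hB, h.anti hB (by linarith)⟩

theorem LocallyHolder.of_dyadicLimit {f : (Fin d → ℝ) → ℝ} {η : ℝ≥0} (hη : 0 < η)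
    (hf : ∀ M : ℕ, ∃ B : ℝ, 0 ≤ B ∧ DyadicHolder f M B η) : LocallyHolder η (dyadicLimit f) := by
  intro x
  obtain ⟨M, hM⟩ := exists_nat_ge (‖x‖ + 1)
  obtain ⟨B, hB, h⟩ := hf M
  obtain ⟨C, hC0, hC⟩ := h.exists_dist_dyadicLimit_le hB hη
  refine ⟨C.toNNReal, Metric.ball x (1 / 2), Metric.ball_mem_nhds _ (by norm_num),
    fun y hy z hz => ?_⟩
  have hnorm : ∀ y ∈ Metric.ball x (1 / 2), ‖y‖ ≤ M := fun y hy => by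
    have := norm_le_norm_add_norm_sub' y x
    rw [← dist_eq_norm] at this
    linarith [Metric.mem_ball.1 hy]
  have hyz : dist y z ≤ 1 := by
    linarith [dist_triangle_right y z x, Metric.mem_ball.1 hy, Metric.mem_ball.1 hz]
  have := hC y z (hnorm y hy) (hnorm z hz) hyz
  rw [edist_dist, edist_dist, ENNReal.ofReal_rpow_of_nonneg dist_nonneg η.coe_nonneg,
    ← ENNReal.ofReal, ← ENNReal.ofReal_mul hC0]
  exact ENNReal.ofReal_le_ofReal this

/-- **Kolmogorov–Chentsov**: a process on `ℝ^d` that is locally `γ`-Hölder continuous in every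
`Lⁿ` has a modification whose paths are locally `η`-Hölder continuous for all `η < γ`. -/
theorem exists_modification_locallyHolder {Y : (Fin d → ℝ) → Ω → ℝ} (hY : ∀ x, Measurable (Y x))
    {γ : ℝ} (hγ : 0 < γ)
    (hmom : ∀ M n : ℕ, ∃ C : ℝ≥0, ∀ u v : Fin d → ℝ, ‖u‖ ≤ M → ‖v‖ ≤ M →
      ∫⁻ ω, ‖Y u ω - Y v ω‖ₑ ^ n ∂P ≤ C * edist u v ^ (γ * n)) :
    ∃ X : (Fin d → ℝ) → Ω → ℝ, (∀ x, Measurable (X x)) ∧ (∀ x, X x =ᵐ[P] Y x) ∧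
      ∀ᵐ ω ∂P, ∀ η : ℝ≥0, 0 < η → (η : ℝ) < γ → LocallyHolder η (fun x => X x ω) := by
  have hae := ae_forall_exists_dyadicHolder hY hγ hmom
  refine ⟨fun x ω => dyadicLimit (fun y => Y y ω) x, fun x => Measurable.limsup fun n => hY _,
    fun x => ?_, ?_⟩
  -- `Y` converges in `L¹` to `Y x` along the dyadic approximations, hence a.s. along a subsequence
  · set u : ℕ → (Fin d → ℝ) := fun n => dyadicPoint n (dyadicFloor n x) with hu
    have hux : Filter.Tendsto (fun n => edist (u n) x) Filter.atTop (𝓝 0) := by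
      rw [← tendsto_iff_edist_tendsto_0, tendsto_iff_dist_tendsto_zero]
      exact squeeze_zero (fun _ => dist_nonneg) (fun n => dist_dyadicPoint_dyadicFloor_le n x)
        (tendsto_pow_atTop_nhds_zero_of_lt_one (by norm_num) (by norm_num))
    obtain ⟨M, hM⟩ := exists_nat_ge (‖x‖ + 1)
    obtain ⟨C, hC⟩ := hmom M 1
    have hnorm : ∀ n, ‖u n‖ ≤ M := fun n => by
      have h1 := norm_le_norm_add_norm_sub' (u n) x
      rw [← dist_eq_norm] at h1
      have h2 := dist_dyadicPoint_dyadicFloor_le n x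
      have h3 : ((1 : ℝ) / 2) ^ n ≤ 1 := pow_le_one₀ (by norm_num) (by norm_num)
      linarith
    have hmeas : TendstoInMeasure P (fun n => Y (u n)) Filter.atTop (Y x) := by
      refine tendstoInMeasure_of_tendsto_eLpNorm one_ne_zero
        (fun n => (hY _).aestronglyMeasurable) (hY x).aestronglyMeasurable ?_
      have h0 : Filter.Tendsto (fun n => (C : ℝ≥0∞) * edist (u n) x ^ γ) Filter.atTop (𝓝 0) := by
        have := ENNReal.Tendsto.const_mul (a := (C : ℝ≥0∞)) (hux.ennrpow_const γ)
          (Or.inr ENNReal.coe_ne_top)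
        rwa [ENNReal.zero_rpow_of_pos hγ, mul_zero] at this
      refine tendsto_of_tendsto_of_tendsto_of_le_of_le tendsto_const_nhds h0
        (fun _ => zero_le) fun n => ?_
      have := hC (u n) x (hnorm n) (by linarith)
      simpa [eLpNorm_one_eq_lintegral_enorm] using this
    obtain ⟨ns, hns, hlim⟩ := hmeas.exists_seq_tendsto_ae
    filter_upwards [hae, hlim] with ω h1 h2
    obtain ⟨B, hB, h⟩ := h1 M (γ / 2) (by linarith)
    exact tendsto_nhds_unique
      ((h.tendsto_dyadicLimit hB (by linarith) (by linarith)).comp hns.tendsto_atTop) h2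
  · filter_upwards [hae] with ω hω η hη hηγ
    exact LocallyHolder.of_dyadicLimit hη fun M => hω M η hηγ

end Modification

/-! ### Moments of the increments of the field -/

theorem lintegral_enorm_pow_gaussianReal_ne_top (n : ℕ) :
    ∫⁻ x, ‖x‖ₑ ^ n ∂gaussianReal 0 1 ≠ ∞ := by
  rcases n.eq_zero_or_pos with rfl | hn
  · simp
  · have h := (memLp_id_gaussianReal (μ := 0) (v := 1) (n : ℝ≥0)).2
    rw [eLpNorm_lt_top_iff_lintegral_rpow_enorm_lt_top (by simpa using hn.ne') (by simp)] at h
    simpa using h.ne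

theorem lintegral_enorm_pow_gaussianReal (σ : ℝ) (n : ℕ) :
    ∫⁻ x, ‖x‖ₑ ^ n ∂gaussianReal 0 (σ ^ 2).toNNReal
      = ‖σ‖ₑ ^ n * ∫⁻ x, ‖x‖ₑ ^ n ∂gaussianReal 0 1 := by
  have h : gaussianReal 0 (σ ^ 2).toNNReal = (gaussianReal 0 1).map (σ * ·) := by
    rw [gaussianReal_map_const_mul, mul_zero, mul_one]
    congr 1
    exact NNReal.eq (Real.coe_toNNReal _ (sq_nonneg σ))
  rw [h, lintegral_map (by fun_prop) (by fun_prop),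
    ← lintegral_const_mul' _ _ (ENNReal.pow_ne_top enorm_ne_top)]
  simp_rw [enorm_mul, mul_pow]

theorem IsGaussianFreeField.variance_sub {Ω : Type*} [MeasurableSpace Ω] {P : Measure Ω}
    [IsProbabilityMeasure P] {D : Opens ℂ} {h : DirichletSpace D → Ω → ℝ}
    (hh : IsGaussianFreeField P D h) (f g : DirichletSpace D) :
    Var[h f - h g; P] = ‖f - g‖ ^ 2 := by
  have hL : ∀ f, MemLp (h f) 2 P := fun f =>
    (hh.isGaussianProcess.hasGaussianLaw_eval f).memLp_two
  have hV : ∀ f, Var[h f; P] = ‖f‖ ^ 2 := fun f => by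
    rw [← covariance_self (hL f).aemeasurable, hh.covariance_eq, real_inner_self_eq_norm_sq]
  rw [ProbabilityTheory.variance_sub (hL f) (hL g), hV, hV, hh.covariance_eq,
    norm_sub_sq_real]

theorem IsGaussianFreeField.lintegral_enorm_sub_pow {Ω : Type*} [MeasurableSpace Ω] {P : Measure Ω}
    [IsProbabilityMeasure P] {D : Opens ℂ} {h : DirichletSpace D → Ω → ℝ}
    (hh : IsGaussianFreeField P D h) (f g : DirichletSpace D) (n : ℕ) :
    ∫⁻ ω, ‖h f ω - h g ω‖ₑ ^ n ∂P
      = edist f g ^ n * ∫⁻ x, ‖x‖ₑ ^ n ∂gaussianReal 0 1 := by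
  have hG := hh.isGaussianProcess.hasGaussianLaw_sub (s := f) (t := g)
  have hi : ∀ f, Integrable (h f) P := fun f =>
    (hh.isGaussianProcess.hasGaussianLaw_eval f).integrable
  have hmean : ∫ ω, (h f - h g) ω ∂P = 0 := by
    simp only [Pi.sub_apply]
    rw [integral_sub (hi f) (hi g), hh.integral_eq_zero, hh.integral_eq_zero, sub_zero]
  have hmap := hG.map_eq_gaussianReal
  rw [hmean, hh.variance_sub] at hmap
  calc _ = ∫⁻ x, ‖x‖ₑ ^ n ∂(P.map (h f - h g)) := by
        rw [lintegral_map' (by fun_prop) hG.aemeasurable]; rfl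
    _ = _ := by
        rw [hmap, lintegral_enorm_pow_gaussianReal, edist_eq_enorm_sub, enorm_norm]

/-! ### Logarithmic coordinates on the set of circles -/

theorem LocallyHolder.comp_locallyLipschitz {X Y Z : Type*} [PseudoEMetricSpace X]
    [PseudoEMetricSpace Y] [PseudoEMetricSpace Z] {η : ℝ≥0} {f : Y → Z} {g : X → Y}
    (hf : LocallyHolder η f) (hg : LocallyLipschitz g) : LocallyHolder η (fun x => f (g x)) := by
  intro x
  obtain ⟨C, t, ht, hC⟩ := hf (g x)
  obtain ⟨K, s, hs, hK⟩ := hg x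
  refine ⟨C * K ^ (η : ℝ), g ⁻¹' t ∩ s,
    Filter.inter_mem (hg.continuous.continuousAt.preimage_mem_nhds ht) hs, ?_⟩
  have := hC.comp (hK.mono inter_subset_right).holderOnWith
    (fun y (hy : y ∈ g ⁻¹' t ∩ s) => hy.1)
  rwa [mul_one] at this

/-- The logarithmic parametrization `(a, b, t) ↦ (a + i b, eᵗ)` of the set of circles by `ℝ³`. -/
noncomputable def circleOfLog (x : Fin 3 → ℝ) : ℂ × Ioi (0 : ℝ) :=
  (⟨x 0, x 1⟩, ⟨Real.exp (x 2), Real.exp_pos _⟩)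

/-- The coordinates `(Re z, Im z, log ε)` of the circle `(z, ε)`. -/
noncomputable def logOfCircle (p : ℂ × Ioi (0 : ℝ)) : Fin 3 → ℝ :=
  ![p.1.re, p.1.im, Real.log p.2]

theorem circleOfLog_logOfCircle (p : ℂ × Ioi (0 : ℝ)) : circleOfLog (logOfCircle p) = p := by
  obtain ⟨z, ε, hε⟩ := p
  refine Prod.ext ?_ (Subtype.ext ?_)
  · simp [circleOfLog, logOfCircle]
  · simpa [circleOfLog, logOfCircle] using Real.exp_log hε

theorem exp_sub_exp_le {s t M : ℝ} (hs : s ≤ M) :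
    Real.exp s - Real.exp t ≤ Real.exp M * |s - t| := by
  have h1 : Real.exp t = Real.exp s * Real.exp (t - s) := by rw [← Real.exp_add]; ring_nf
  have h2 := Real.add_one_le_exp (t - s)
  calc _ = Real.exp s * (1 - Real.exp (t - s)) := by rw [h1]; ring
    _ ≤ Real.exp s * |s - t| := by gcongr; linarith [le_abs_self (s - t)]
    _ ≤ _ := by gcongr

theorem dist_circleOfLog_le {M : ℝ} (hM : 0 ≤ M) {u v : Fin 3 → ℝ} (hu : ‖u‖ ≤ M)
    (hv : ‖v‖ ≤ M) : dist (circleOfLog u) (circleOfLog v) ≤ 2 * Real.exp M * dist u v := by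
  have hd : ∀ i, |u i - v i| ≤ dist u v := fun i => dist_le_pi_dist u v i
  have hd0 : 0 ≤ dist u v := dist_nonneg
  have hle : ∀ {w : Fin 3 → ℝ}, ‖w‖ ≤ M → w 2 ≤ M := fun hw =>
    (le_abs_self _).trans ((norm_le_pi_norm _ 2).trans hw)
  have hM1 : 1 ≤ Real.exp M := Real.one_le_exp hM
  rw [Prod.dist_eq]
  refine max_le ?_ ?_
  · rw [dist_eq_norm]
    refine (Complex.norm_le_abs_re_add_abs_im _).trans ?_
    have h0 := hd 0
    have h1 := hd 1
    simp only [circleOfLog, Complex.sub_re, Complex.sub_im]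
    nlinarith
  · change |Real.exp (u 2) - Real.exp (v 2)| ≤ _
    have h1 := exp_sub_exp_le (t := v 2) (hle hu)
    have h2 := exp_sub_exp_le (t := u 2) (hle hv)
    rw [abs_sub_comm (v 2)] at h2
    have h3 : Real.exp M * |u 2 - v 2| ≤ 2 * Real.exp M * dist u v := by
      gcongr
      · linarith
      · exact hd 2
    exact abs_le.2 ⟨by linarith, by linarith⟩

theorem log_sub_log_le {s t r : ℝ} (hr : 0 < r) (hs : 0 < s) (ht : r ≤ t) :
    Real.log s - Real.log t ≤ |s - t| / r := by
  have ht0 : 0 < t := hr.trans_le ht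
  rw [← Real.log_div hs.ne' ht0.ne']
  calc _ ≤ s / t - 1 := Real.log_le_sub_one_of_pos (by positivity)
    _ = (s - t) / t := by field_simp
    _ ≤ |s - t| / t := by gcongr; exact le_abs_self _
    _ ≤ _ := by gcongr

theorem locallyLipschitz_logOfCircle : LocallyLipschitz logOfCircle := by
  rintro ⟨z, ε, hε⟩
  have hε0 : 0 < ε := hε
  set K : ℝ := 1 + 2 / ε with hK
  have hK0 : 0 ≤ K := by positivity
  refine ⟨K.toNNReal, {p | ε / 2 < p.2}, ?_, LipschitzOnWith.of_dist_le_mul fun p hp q hq => ?_⟩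
  · exact (isOpen_lt continuous_const (by fun_prop)).mem_nhds (half_lt_self hε0)
  · have h0 : 0 ≤ dist p q := dist_nonneg
    have h1 : dist p.1 q.1 ≤ dist p q := le_max_left _ _
    have h2 : |(p.2 : ℝ) - q.2| ≤ dist p q := le_max_right (dist p.1 q.1) (dist p.2 q.2)
    have h3 : 0 ≤ 2 / ε := by positivity
    have hK1 : dist p q ≤ K * dist p q := le_mul_of_one_le_left h0 (by linarith)
    rw [dist_eq_norm] at h1
    have h4 : |(p.2 : ℝ) - q.2| / (ε / 2) ≤ K * dist p q := by
      rw [hK, div_div_eq_mul_div, mul_div_assoc, mul_comm]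
      gcongr
      linarith
    rw [Real.coe_toNNReal _ hK0]
    refine (dist_pi_le_iff (by positivity)).2 fun i => ?_
    rw [Real.dist_eq]
    fin_cases i
    · exact (Complex.abs_re_le_norm (p.1 - q.1)).trans (h1.trans hK1)
    · exact (Complex.abs_im_le_norm (p.1 - q.1)).trans (h1.trans hK1)
    · change |Real.log p.2 - Real.log q.2| ≤ _
      have h5 := log_sub_log_le (half_pos hε0) p.2.2 (le_of_lt hq)
      have h6 := log_sub_log_le (half_pos hε0) q.2.2 (le_of_lt hp)
      rw [abs_sub_comm] at h6
      exact abs_le.2 ⟨by linarith, by linarith⟩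

theorem exists_edist_circleRep_circleOfLog_le {D : Opens ℂ}
    (hD : Bornology.IsBounded (D : Set ℂ)) {M : ℝ} (hM : 0 ≤ M) :
    ∃ K : ℝ≥0, ∀ u v : Fin 3 → ℝ, ‖u‖ ≤ M → ‖v‖ ≤ M →
      edist (circleRep hD (circleOfLog u)) (circleRep hD (circleOfLog v))
        ≤ K * edist u v ^ (1 / 2 : ℝ) := by
  set K : ℝ := 14 * √(2 * Real.exp M / Real.exp (-M)) with hK
  have hK0 : 0 ≤ K := by positivity
  refine ⟨K.toNNReal, fun u v hu hv => ?_⟩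
  have hr : ∀ {w : Fin 3 → ℝ}, ‖w‖ ≤ M → Real.exp (-M) ≤ (circleOfLog w).2 := fun {w} hw =>
    Real.exp_le_exp.2 (abs_le.1 ((norm_le_pi_norm w 2).trans hw)).1
  rw [edist_dist, edist_dist, ENNReal.ofReal_rpow_of_nonneg dist_nonneg (by norm_num),
    ← ENNReal.ofReal, ← ENNReal.ofReal_mul hK0]
  refine ENNReal.ofReal_le_ofReal ((dist_circleRep_le hD (Real.exp_pos _) (hr hu) (hr hv)).trans ?_)
  rw [hK, ← Real.sqrt_eq_rpow, mul_assoc, ← Real.sqrt_mul (by positivity), div_mul_eq_mul_div]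
  gcongr
  exact dist_circleOfLog_le hM hu hv

end GFF

theorem proposition3p1 {Ω : Type*} [MeasurableSpace Ω] (P : Measure Ω) [IsProbabilityMeasure P]
    (D : Opens ℂ) (hconn : IsConnected (D : Set ℂ)) (hD : Bornology.IsBounded (D : Set ℂ))
    (h : GFF.DirichletSpace D → Ω → ℝ) (hh : GFF.IsGaussianFreeField P D h) :
    ∃ X : ℂ × Ioi (0 : ℝ) → Ω → ℝ,
      (∀ p, Measurable (X p)) ∧
      (∀ p, X p =ᵐ[P] GFF.circleAverageProcess hD h p) ∧
      ∀ᵐ ω ∂P, ∀ η : ℝ≥0, 0 < η → (η : ℝ) < 1 / 2 → GFF.LocallyHolder η (fun p => X p ω) := by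
  -- the modification has to be measurable, but `h` itself is only a.e. measurable
  have hm := hh.isGaussianProcess.aemeasurable
  set Y : (Fin 3 → ℝ) → Ω → ℝ := fun u => (hm (GFF.circleRep hD (GFF.circleOfLog u))).mk with hY
  have hYh : ∀ u, h (GFF.circleRep hD (GFF.circleOfLog u)) =ᵐ[P] Y u := fun u => (hm _).ae_eq_mk
  obtain ⟨X, hXm, hXY, hX⟩ := GFF.exists_modification_locallyHolder (P := P) (Y := Y)
    (γ := 1 / 2) (fun u => (hm _).measurable_mk) (by norm_num) fun M n => by
      obtain ⟨K, hK⟩ := GFF.exists_edist_circleRep_circleOfLog_le hD M.cast_nonneg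
      set c := ∫⁻ x, ‖x‖ₑ ^ n ∂gaussianReal 0 1 with hc
      refine ⟨K ^ n * c.toNNReal, fun u v hu hv => ?_⟩
      calc ∫⁻ ω, ‖Y u ω - Y v ω‖ₑ ^ n ∂P
          = ∫⁻ ω, ‖h (GFF.circleRep hD (GFF.circleOfLog u)) ω
              - h (GFF.circleRep hD (GFF.circleOfLog v)) ω‖ₑ ^ n ∂P := by
            refine lintegral_congr_ae ?_
            filter_upwards [hYh u, hYh v] with ω h1 h2
            rw [h1, h2]
        _ = edist (GFF.circleRep hD (GFF.circleOfLog u))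
              (GFF.circleRep hD (GFF.circleOfLog v)) ^ n * c := hh.lintegral_enorm_sub_pow _ _ n
        _ ≤ (K * edist u v ^ (1 / 2 : ℝ)) ^ n * c := by
            gcongr
            exact hK u v hu hv
        _ = _ := by
            rw [mul_pow, ENNReal.rpow_mul, ENNReal.rpow_natCast, ENNReal.coe_mul, ENNReal.coe_pow,
              ENNReal.coe_toNNReal (GFF.lintegral_enorm_pow_gaussianReal_ne_top n)]
            ring
  refine ⟨fun p => X (GFF.logOfCircle p), fun p => hXm _, fun p => ?_, ?_⟩
  · refine (hXY _).trans ((hYh _).symm.trans ?_)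
    rw [GFF.circleOfLog_logOfCircle]
    rfl
  · filter_upwards [hX] with ω hω η hη hη2
    exact (hω η hη hη2).comp_locallyLipschitz GFF.locallyLipschitz_logOfCircle
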